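/- Let $G=\mathbb Z_2=\{1,-1\}$, $G^0=\{0,1,-1\}$, $B=\{1',3',1,2,3,4\}$ and let $C:B\times A\to G^0$, $A=\{a_1,\dots,a_7\}$, be the $0/1$ matrix for which row $a_i$ of $C^T$ has its entries $1$ exactly in the columns $a_1:\{1',3'\}$, $a_2:\{1'\}$, $a_3:\{3'\}$, $a_4:\{1,2\}$, $a_5:\{2,3\}$, $a_6:\{3,4\}$, $a_7:\{1,4\}$. Write a row-monomial $B\times B$ matrix over $G^0$ as a $G$-labelled partial function on $B$, acting on the right of $G\times B$ by $(g,b)X=(gh,b')$ if row $b$ of $X$ has the entry $h$ in column $b'$. The translational hull of the Rees matrix semigroup $\mathcal M^0(G,A,B,C)$ is the semigroup of pairs $(X,Y)$ of a row-monomial $B\times B$ matrix $X$ and a column-monomial $A\times A$ matrix $Y$ with $XC=CY$. The Tall Fork $TF$ is its subsemigroup generated by the pairs whose first component is one of: an element $(a,g,b)\in\mathcal M^0(G,A,B,C)$ (i.e. $b'\mapsto C(b',a)g\,b$); $\sigma=(1'\,3')$, with domain $\{1',3'\}$; $\tau=(1\,2\,3\,4)$, with domain $\{1,2,3,4\}$;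 $r:1'\mapsto 1,\ 3'\mapsto -3$. Let $TFA1$ be the semigroup defined in the same way after deleting row $a_1$ from $C^T$, and let $X$ be its set of generators $(a,g,b),\sigma,\tau,r$. Then: 1. The structure matrix of $TFA1$ is regular and has no two distinct proportional rows or columns (so $TFA1$ is a group mapping semigroup), each generator in $X$ is linked with exactly one column-monomial matrix, and $TFA1$ embeds in $TF$ compatibly with the actions on $G\times B$. 2. Let $X$ act on $\{p,q\}$ as follows: $(a,g,b)$ is the constant map to $p$ if $b\in\{1',3'\}$ and the constant map to $q$ if $b\in\{1,2,3,4\}$; $\sigma,\tau$ are the identity; $r$ is the constant map to $q$. The semigroup of this automaton is the flip-flop $RZ(\{p,q\})^1$ (the two constant maps and the identity), which is aperiodic. The map $$p\mapsto \{1'\,3'\}/\langle 1\ \ {-1}\rangle,\qquad q\mapsto \{1\,2\,3\,4\}/\langle 1\ 1\ 1\ 1\rangle$$ is a complete flow from this automaton to the Rhodes lattice $Rh_B(G)$. Here $I/\langle f\rangle$, for $f:I\to G$, denotes the one-block subset-partition-cross-section on $I$, identified with the pair $(G\times I,\Pi)$ with blocks $\{(kf(b),b): b\in I\}$, $k\in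 G$. A flow from an automaton with state set $Q$ and alphabet $X$ assigns to each state $s$ a pair $(Y_s,\Pi_s)$ of a $G$-invariant subset $Y_s\subseteq G\times B$ and a $G$-invariant partition $\Pi_s$ of it, each block containing at most one element over each $b\in B$, such that the $Y_s$ cover $G\times B$ and, whenever $sx$ is defined, $Y_sx\subseteq Y_{sx}$ and for $y,y'\in Y_s$ with $yx,y'x$ defined, $y,y'$ lie in the same block of $\Pi_s$ iff $yx,y'x$ lie in the same block of $\Pi_{sx}$. It is complete if, extended by $(\emptyset,\emptyset)$ on an adjoined sink state that receives all undefined transitions, it remains a flow. 3. The Krohn–Rhodes complexity of $TFA1$ is $1$, where the complexity of a finite semigroup $S$ is the least $n$ such that $S$ divides an iterated wreath product $A_n\wr G_n\wr\cdots\wr A_1\wr G_1\wr A_0$ with finite aperiodic semigroups $A_i$ and finite groups $G_i$. -/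

import Mathlib

namespace KR

/-! ## Krohn-Rhodes complexity of finite semigroups -/

/-- Every subgroup is trivial: the unit group of each local monoid `eSe` is `{e}`. -/
def IsAperiodic (S : Type) [Semigroup S] : Prop :=
  ∀ e g h : S, e * e = e → e * g = g → g * e = g → g * h = e → h * g = e → g = e

/-- `S ≺ T`: `S` is a homomorphic image of a subsemigroup of `T`. -/
def Divides (S T : Type) [Semigroup S] [Semigroup T] : Prop :=
  ∃ (U : Subsemigroup T) (φ : U →ₙ* S), Function.Surjective φ

/-- The wreath product `S ≀ T` of semigroups, that is, the semidirect product of `S ^ (T¹)` with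
`T`, where `T¹` is `T` with an identity adjoined. -/
@[ext]
structure Wreath (S T : Type) where
  fn : WithOne T → S
  base : T

instance (S T : Type) [Semigroup S] [Semigroup T] : Semigroup (Wreath S T) where
  mul x y := ⟨fun u => x.fn u * y.fn (u * (x.base : WithOne T)), x.base * y.base⟩
  mul_assoc x y z := by
    apply Wreath.ext
    · funext u
      change (x.fn u * y.fn (u * x.base)) * z.fn (u * ((x.base * y.base : T) : WithOne T)) =
        x.fn u * (y.fn (u * x.base) * z.fn (u * x.base * y.base))
      rw [WithOne.coe_mul, mul_assoc, mul_assoc]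
    · exact mul_assoc x.base y.base z.base

/-- `S` divides an iterated wreath product `A_n ≀ G_n ≀ ⋯ ≀ A_1 ≀ G_1 ≀ A_0` with finite aperiodic
semigroups `A_i` and finite groups `G_i`. -/
def ComplexityLE : ℕ → (S : Type) → [Semigroup S] → Prop
  | 0, S, _ => Finite S ∧ IsAperiodic S
  | n + 1, S, _ => ∃ (A G T : Type) (_ : Semigroup A) (_ : Group G) (_ : Semigroup T),
      Finite A ∧ IsAperiodic A ∧ Finite G ∧ ComplexityLE n T ∧
        Divides S (Wreath A (Wreath G T))

/-- The Krohn-Rhodes complexity of `S` is `n`: `n` is the least number of group factors. -/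
def HasComplexity (S : Type) [Semigroup S] (n : ℕ) : Prop :=
  IsLeast {m | ComplexityLE m S} n

/-! ## Monomial matrices and the translational hull of a Rees matrix semigroup -/

section Hull

variable (A B G : Type)

/-- Row-monomial `B × B` matrices over `G⁰`, as `G`-labelled partial functions:
`X.row b = some (g, b')` says that the only non-zero entry of row `b` is `g`, in column `b'`. -/
@[ext]
structure RM where
  row : B → Option (G × B)

/-- Column-monomial `A × A` matrices over `G⁰`: `Y.col a = some (a', g)` says that the only
non-zero entry of column `a` is `g`, in row `a'`. -/
@[ext]
structure CM where
  col : A → Option (A × G)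

variable {A B G} [Group G]

/-- Matrix multiplication of row-monomial matrices. -/
instance : Semigroup (RM B G) where
  mul X Y := ⟨fun b => (X.row b).bind fun p => (Y.row p.2).map fun q => (p.1 * q.1, q.2)⟩
  mul_assoc X Y Z := by
    apply RM.ext
    funext b
    change ((((X.row b).bind fun p => (Y.row p.2).map fun q => (p.1 * q.1, q.2))).bind fun p =>
      (Z.row p.2).map fun q => (p.1 * q.1, q.2)) = ((X.row b).bind fun p =>
        ((Y.row p.2).bind fun p => (Z.row p.2).map fun q => (p.1 * q.1, q.2)).map
          fun q => (p.1 * q.1, q.2))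
    cases X.row b with
    | none => rfl
    | some p =>
      dsimp
      cases Y.row p.2 with
      | none => rfl
      | some q =>
        dsimp
        cases Z.row q.2 with
        | none => rfl
        | some t => simp [mul_assoc]

/-- Matrix multiplication of column-monomial matrices. -/
instance : Semigroup (CM A G) where
  mul X Y := ⟨fun a => (Y.col a).bind fun p => (X.col p.1).map fun q => (q.1, q.2 * p.2)⟩
  mul_assoc X Y Z := by
    apply CM.ext
    funext a
    change ((Z.col a).bind fun p =>
        ((Y.col p.1).bind fun p => (X.col p.1).map fun q => (q.1, q.2 * p.2)).map
          fun q => (q.1, q.2 * p.2)) =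
      (((Z.col a).bind fun p => (Y.col p.1).map fun q => (q.1, q.2 * p.2))).bind fun p =>
        (X.col p.1).map fun q => (q.1, q.2 * p.2)
    cases Z.col a with
    | none => rfl
    | some p =>
      dsimp
      cases Y.col p.1 with
      | none => rfl
      | some q =>
        dsimp
        cases X.col q.1 with
        | none => rfl
        | some t => simp [mul_assoc]

/-- The entry at `(b, a)` of the matrix product `X C`. -/
def RM.mulEntry (X : RM B G) (C : B → A → WithZero G) (b : B) (a : A) : WithZero G :=
  (X.row b).elim 0 fun p => (p.1 : WithZero G) * C p.2 a

/-- The entry at `(b, a)` of the matrix product `C Y`. -/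
def CM.mulEntry (C : B → A → WithZero G) (Y : CM A G) (b : B) (a : A) : WithZero G :=
  (Y.col a).elim 0 fun p => C b p.1 * (p.2 : WithZero G)

/-- `X` and `Y` are linked: `X C = C Y`. -/
def Linked (C : B → A → WithZero G) (X : RM B G) (Y : CM A G) : Prop :=
  ∀ b a, X.mulEntry C b a = CM.mulEntry C Y b a

theorem Linked.mul {C : B → A → WithZero G} {X X' : RM B G} {Y Y' : CM A G}
    (h : Linked C X Y) (h' : Linked C X' Y') : Linked C (X * X') (Y * Y') := by
  intro b a
  have e1 : (X * X').mulEntry C b a =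
      (X.row b).elim 0 fun p => (p.1 : WithZero G) * X'.mulEntry C p.2 a := by
    change (((X.row b).bind fun p => (X'.row p.2).map fun q => (p.1 * q.1, q.2))).elim 0
      (fun p => (p.1 : WithZero G) * C p.2 a) = _
    cases X.row b with
    | none => rfl
    | some p =>
      simp only [Option.bind_some, Option.elim_some, RM.mulEntry]
      cases X'.row p.2 <;> simp [mul_assoc]
  have e2 : CM.mulEntry C (Y * Y') b a =
      (Y'.col a).elim 0 fun p => CM.mulEntry C Y b p.1 * (p.2 : WithZero G) := by
    change (((Y'.col a).bind fun p => (Y.col p.1).map fun q => (q.1, q.2 * p.2))).elim 0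
      (fun p => C b p.1 * (p.2 : WithZero G)) = _
    cases Y'.col a with
    | none => rfl
    | some p =>
      simp only [Option.bind_some, Option.elim_some, CM.mulEntry]
      cases Y.col p.1 <;> simp [mul_assoc]
  rw [e1, e2]
  have e3 : ((X.row b).elim 0 fun p => (p.1 : WithZero G) * X'.mulEntry C p.2 a) =
      (X.row b).elim 0 fun p => (p.1 : WithZero G) * CM.mulEntry C Y' p.2 a := by
    cases X.row b with
    | none => rfl
    | some p => simp only [Option.elim_some, h' p.2 a]
  have e4 : ((Y'.col a).elim 0 fun p => CM.mulEntry C Y b p.1 * (p.2 : WithZero G)) =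
      (Y'.col a).elim 0 fun p => X.mulEntry C b p.1 * (p.2 : WithZero G) := by
    cases Y'.col a with
    | none => rfl
    | some p => simp only [Option.elim_some, h b p.1]
  rw [e3, e4]
  unfold RM.mulEntry CM.mulEntry
  cases X.row b <;> cases Y'.col a <;> simp [mul_assoc]

/-- The translational hull `Ω(M⁰(G,A,B,C))`: all linked pairs. -/
@[ext]
structure Hull (C : B → A → WithZero G) where
  right : RM B G
  left : CM A G
  linked : Linked C right left

instance (C : B → A → WithZero G) : Semigroup (Hull C) where
  mul s t := ⟨s.right * t.right, s.left * t.left, s.linked.mul t.linked⟩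
  mul_assoc s t u := Hull.ext (mul_assoc s.right t.right u.right) (mul_assoc s.left t.left u.left)

/-- The structure matrix is regular, has no two distinct proportional rows or columns, and the
structure group is non-trivial; a semigroup between `M⁰(G,A,B,C)` and its translational hull is
then a group mapping semigroup. -/
def IsGMMatrix (C : B → A → WithZero G) : Prop :=
  Nontrivial G ∧ (∀ b, ∃ a, C b a ≠ 0) ∧ (∀ a, ∃ b, C b a ≠ 0) ∧
    (∀ b b', (∃ g : G, ∀ a, (g : WithZero G) * C b a = C b' a) → b = b') ∧
    (∀ a a', (∃ g : G, ∀ b, C b a * (g : WithZero G) = C b a') → a = a')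

/-- The element `(a, g, b)` of `M⁰(G,A,B,C)` as a row-monomial matrix: row `b'` has the entry
`C(b', a) g` in column `b`. -/
def rees (C : B → A → WithZero G) (a : A) (g : G) (b : B) : RM B G :=
  ⟨fun b' => (show Option G from C b' a).map fun c => (c * g, b)⟩

/-- The right action of `X` by partial maps on `G × B`: `(g, b) X = (g h, b')` if row `b` of `X`
has the entry `h` in column `b'`. -/
def RM.act (X : RM B G) (y : G × B) : Option (G × B) :=
  (X.row y.2).map fun p => (y.1 * p.1, p.2)

end Hull

/-! ## The set-partition lattice, invariant cross-sections and SPCs -/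

/-- An element `(Y, Π)` of the set-partition lattice of `α`: a subset `carrier` and an equivalence
relation `rel` on it. -/
@[ext]
structure SP (α : Type) where
  carrier : Set α
  rel : α → α → Prop
  mem_of_rel : ∀ {y z}, rel y z → y ∈ carrier
  refl : ∀ {y}, y ∈ carrier → rel y y
  symm : ∀ {y z}, rel y z → rel z y
  trans : ∀ {x y z}, rel x y → rel y z → rel x z

/-- The bottom `(∅, ∅)`. -/
def SP.bot (α : Type) : SP α where
  carrier := ∅
  rel _ _ := False
  mem_of_rel h := h.elim
  refl h := h.elim
  symm h := h
  trans h _ := h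

/-- The set `I` with one single block. -/
def SP.oneBlock {α : Type} (I : Set α) : SP α where
  carrier := I
  rel y z := y ∈ I ∧ z ∈ I
  mem_of_rel h := h.1
  refl h := ⟨h, h⟩
  symm h := ⟨h.2, h.1⟩
  trans h h' := ⟨h.1, h'.2⟩

section Flow

variable {B G X Q : Type} [Group G]

/-- Every block meets each fibre of `G × B → B` at most once. -/
def SP.IsCrossSection (P : SP (G × B)) : Prop :=
  ∀ (g h : G) (b : B), P.rel (g, b) (h, b) → g = h

/-- Invariance under the left action of `G` on `G × B`. -/
def SP.IsInvariant (P : SP (G × B)) : Prop :=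
  (∀ (k : G) (y : G × B), y ∈ P.carrier → (k * y.1, y.2) ∈ P.carrier) ∧
    ∀ (k : G) (y z : G × B), P.rel y z → P.rel (k * y.1, y.2) (k * z.1, z.2)

/-- The invariant cross-section `(G × I, Π)` attached to the SPC `(I, θ, [f])`, where `I` is the
carrier of `θ` (values of `f` outside `I` play no role): the blocks of `Π` are the sets
`{(k f(b), b) | b ∈ t}` for `k ∈ G` and `t` a block of `θ`. Elements of the Rhodes lattice other
than the contradiction are identified with invariant cross-sections in this way. -/
def spc (θ : SP B) (f : B → G) : SP (G × B) where
  carrier := {y | y.2 ∈ θ.carrier}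
  rel y z := θ.rel y.2 z.2 ∧ ∃ k : G, y.1 = k * f y.2 ∧ z.1 = k * f z.2
  mem_of_rel h := θ.mem_of_rel h.1
  refl {y} h := ⟨θ.refl h, y.1 * (f y.2)⁻¹, by simp, by simp⟩
  symm := by
    rintro y z ⟨h, k, h1, h2⟩
    exact ⟨θ.symm h, k, h2, h1⟩
  trans := by
    rintro x y z ⟨h, k, h1, h2⟩ ⟨h', k', h3, h4⟩
    have e : k = k' := mul_right_cancel (h2.symm.trans h3)
    exact ⟨θ.trans h h', k, h1, by rw [h4, e]⟩

/-- A deterministic automaton: each letter defines a partial function on the states. -/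
structure Automaton (X Q : Type) where
  step : Q → X → Option Q

/-- The completion, with the sink `none` adjoined. -/
def Automaton.completion (M : Automaton X Q) : Automaton X (Option Q) where
  step q x := some (q.bind fun q' => M.step q' x)

/-- `f : Q → Rh_B(G)` is a flow on the automaton `M`, where `ev` sends each letter to the element
of the semigroup it stands for, written as a row-monomial matrix. -/
structure IsFlow (ev : X → RM B G) (M : Automaton X Q) (f : Q → SP (G × B)) : Prop where
  covers : ∀ y : G × B, ∃ q, y ∈ (f q).carrier
  maps : ∀ q x q', M.step q x = some q' → ∀ y ∈ (f q).carrier, ∀ z, (ev x).act y = some z →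
    z ∈ (f q').carrier
  injective : ∀ q x q', M.step q x = some q' → ∀ y ∈ (f q).carrier, ∀ y' ∈ (f q).carrier,
    ∀ z z', (ev x).act y = some z → (ev x).act y' = some z' →
      ((f q).rel y y' ↔ (f q').rel z z')
  crossSection : ∀ q, (f q).IsCrossSection
  invariant : ∀ q, (f q).IsInvariant

/-- A complete flow: extended by sending the sink to `(∅, ∅)`, it is a flow on the completion. -/
def IsCompleteFlow (ev : X → RM B G) (M : Automaton X Q) (f : Q → SP (G × B)) : Prop :=
  IsFlow ev M f ∧ IsFlow ev M.completion fun q : Option Q => q.elim (SP.bot (G × B)) f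

/-- Partial functions on `Q`, acting on the right. -/
@[ext]
structure PT (Q : Type) where
  app : Q → Option Q

instance (Q : Type) : Semigroup (PT Q) where
  mul f g := ⟨fun q => (f.app q).bind g.app⟩
  mul_assoc f g h := by
    apply PT.ext
    funext q
    exact Option.bind_assoc (f.app q) g.app h.app

/-- The semigroup of the automaton, generated by the partial functions of the letters. -/
def Automaton.semigroup (M : Automaton X Q) : Subsemigroup (PT Q) :=
  Subsemigroup.closure (Set.range fun x => (⟨fun q => M.step q x⟩ : PT Q))

/-- `RZ(Q)¹`: the constant functions on `Q` and the identity. -/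
def rightZeroOne (Q : Type) : Set (PT Q) :=
  {f | f = ⟨some⟩ ∨ ∃ q, f = ⟨fun _ => some q⟩}

end Flow

/-! ## The Tall Fork and the semigroup obtained by deleting a row -/

/-- The set `B = {1', 3', 1, 2, 3, 4}`. -/
inductive Col
  | one' | three' | one | two | three | four
  deriving DecidableEq

instance : Fintype Col :=
  ⟨{.one', .three', .one, .two, .three, .four}, fun x => by cases x <;> decide⟩

/-- The rows `a_1, …, a_7` of the transposed structure matrix of the Tall Fork. -/
inductive Row
  | a1 | a2 | a3 | a4 | a5 | a6 | a7
  deriving DecidableEq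

instance : Fintype Row :=
  ⟨{.a1, .a2, .a3, .a4, .a5, .a6, .a7}, fun x => by cases x <;> decide⟩

/-- The set of columns in which row `a_i` of the transposed structure matrix has the entry `1`. -/
def Row.support : Row → Finset Col
  | .a1 => {.one', .three'}
  | .a2 => {.one'}
  | .a3 => {.three'}
  | .a4 => {.one, .two}
  | .a5 => {.two, .three}
  | .a6 => {.three, .four}
  | .a7 => {.one, .four}

/-- The structure matrix of the Tall Fork over `ℤ₂ = {1, -1}`, written as `C : B × A → G⁰`. -/
def forkMatrix (b : Col) (a : Row) : WithZero ℤˣ :=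
  if b ∈ a.support then 1 else 0

/-- The structure matrix of the Tall Fork with row `a_1` of its transpose deleted. -/
def forkMatrixA1 (b : Col) (a : {a : Row // a ≠ Row.a1}) : WithZero ℤˣ :=
  forkMatrix b a

/-- `σ = (1' 3')`, defined on `{1', 3'}` only. -/
def sigma : RM Col ℤˣ where
  row
    | .one' => some (1, .three')
    | .three' => some (1, .one')
    | _ => none

/-- `τ = (1 2 3 4)`, defined on `{1, 2, 3, 4}` only. -/
def tau : RM Col ℤˣ where
  row
    | .one => some (1, .two)
    | .two => some (1, .three)
    | .three => some (1, .four)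
    | .four => some (1, .one)
    | _ => none

/-- `r : 1' ↦ 1, 3' ↦ -3`. -/
def rho : RM Col ℤˣ where
  row
    | .one' => some (1, .one)
    | .three' => some (-1, .three)
    | _ => none

/-- The letters naming the generators: all `(a, g, b)`, and `σ`, `τ`, `r`. -/
inductive Letter (A : Type)
  | elt (a : A) (g : ℤˣ) (b : Col)
  | sigma
  | tau
  | r

/-- The row-monomial matrix that a letter stands for. -/
def Letter.eval {A : Type} (C : Col → A → WithZero ℤˣ) : Letter A → RM Col ℤˣ
  | .elt a g b => rees C a g b
  | .sigma => KR.sigma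
  | .tau => KR.tau
  | .r => rho

/-- The subsemigroup of the translational hull of `M⁰(ℤ₂,A,B,C)` generated by the pairs whose
row-monomial component is the matrix of a letter (the column-monomial component is determined by
the row-monomial one if `C` has no proportional columns). -/
def forkSemigroup {A : Type} (C : Col → A → WithZero ℤˣ) : Subsemigroup (Hull C) :=
  Subsemigroup.closure {s | ∃ x : Letter A, s.right = x.eval C}

/-- The Tall Fork. -/
abbrev TF : Subsemigroup (Hull forkMatrix) := forkSemigroup forkMatrix

/-- The Tall Fork with row `a_1` deleted. -/
abbrev TFA1 : Subsemigroup (Hull forkMatrixA1) := forkSemigroup forkMatrixA1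

/-- The states of the flip-flop. -/
inductive State
  | p | q
  deriving DecidableEq

/-- The automaton on `{p, q}`: `(a, g, b)` is covered by the constant map to `p` if
`b ∈ {1', 3'}` and by the constant map to `q` if `b ∈ {1, 2, 3, 4}`; `σ` and `τ` are covered by the
identity and `r` by the constant map to `q`. -/
def flipFlop : Automaton (Letter {a : Row // a ≠ Row.a1}) State where
  step s
    | .elt _ _ b => if b = .one' ∨ b = .three' then some .p else some .q
    | .sigma => some s
    | .tau => some s
    | .r => some .q

/-- `p ↦ {1' 3'}/⟨1 -1⟩` and `q ↦ {1 2 3 4}/⟨1 1 1 1⟩`. -/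
def flow : State → SP (ℤˣ × Col)
  | .p => spc (SP.oneBlock {.one', .three'}) fun b => if b = .three' then -1 else 1
  | .q => spc (SP.oneBlock {.one, .two, .three, .four}) fun _ => 1

end KR

namespace KR

/-! ## Aperiodicity -/

/-! The structure matrix has nonzero, pairwise non-proportional columns, so a linked pair is
determined by its row-monomial half (`Hull.ext_right`). Linking, the embedding and the complexity
bounds thus become statements about signed partial maps on `B`.

The flow rests on one invariant. Index the block of `(k, b)` by `k * b.sign`, where only `3'` has
sign `-1`. Every letter moves all points where it is defined by one common factor on this index
(`act_block`), because all columns in the support of a row other than `a1` have the same sign. Row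
`a1` contains both `1'` and `3'`, so it would merge two blocks; this is why it is deleted.

For the upper bound, a point `(k, b)` is given coordinates: the flip-flop state of `b`, a group
element `(n, ε)` with `n` in `ZMod 4` and `ε` the block index, and `c` in `ZMod 4` such that `n + c`
is the position of `b` in its block. A letter acts on the state through the flip-flop and on `(n,
ε)` by a fixed translation. The rotations of `σ` and `τ` are absorbed by `n`, so on `c` there
remains a restriction of the identity or of a constant map (`decode_step`). Such maps form an
aperiodic semigroup, giving a division with one group layer. The lower bound holds because `σ`
generates a subgroup of order two. -/

theorem isAperiodic_of_cube_eq_sq {S : Type} [Semigroup S]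
    (hS : ∀ f : S, f * f * f = f * f) : IsAperiodic S := by
  intro e g h _ h1 h2 h3 _
  have h4 : g * g = g := by
    have := congrArg (· * h) (hS g)
    simpa only [mul_assoc, h3, h2] using this
  calc g = g * e := h2.symm
    _ = g * (g * h) := by rw [h3]
    _ = g * h := by rw [← mul_assoc, h4]
    _ = e := h3

theorem PT.mul_app {Q : Type} (f g : PT Q) (q : Q) : (f * g).app q = (f.app q).bind g.app := rfl

instance {Q : Type} [Finite Q] : Finite (PT Q) :=
  Finite.of_injective PT.app fun _ _ h => PT.ext h

/-! ## The translational hull -/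

section Hull

variable {A B G : Type} [Group G]

theorem RM.mul_act (X Y : RM B G) (y : G × B) : (X * Y).act y = (X.act y).bind Y.act := by
  change ((X.row y.2).bind fun p => (Y.row p.2).map fun q => (p.1 * q.1, q.2)).map _ =
    ((X.row y.2).map fun p => (y.1 * p.1, p.2)).bind Y.act
  cases X.row y.2 with
  | none => rfl
  | some p =>
    simp only [Option.bind_some, Option.map_some, RM.act, Option.map_map]
    cases Y.row p.2 <;> simp [mul_assoc]

theorem RM.ext_act {X Y : RM B G} (h : ∀ y, X.act y = Y.act y) : X = Y := by
  apply RM.ext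
  funext b
  simpa [RM.act] using h (1, b)

theorem linked_iff {C : B → A → WithZero G} {X : RM B G} {Y : CM A G} :
    Linked C X Y ↔ ∀ a b, X.mulEntry C b a = (Y.col a).elim 0 fun p => C b p.1 * (p.2 : WithZero G) :=
  forall_comm

/-- Column `a` of `C Y` involves only column `a` of `Y`, so the columns can be chosen independently.
For the finite matrices below this leaves a search that `decide` can settle. -/
theorem exists_linked_iff {C : B → A → WithZero G} {X : RM B G} :
    (∃ Y, Linked C X Y) ↔ ∀ a, ∃ p : Option (A × G),
      ∀ b, X.mulEntry C b a = p.elim 0 fun p => C b p.1 * (p.2 : WithZero G) := by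
  constructor
  · rintro ⟨Y, hY⟩ a
    exact ⟨Y.col a, linked_iff.1 hY a⟩
  · intro h
    choose p hp using h
    exact ⟨⟨p⟩, linked_iff.2 hp⟩

theorem linked_rees (C : B → A → WithZero G) (a : A) (g : G) (b : B) :
    ∃ Y, Linked C (rees C a g b) Y := by
  rw [exists_linked_iff]
  intro a'
  -- `X C` is column `a` of `C` times `g` times row `b` of `C`; hence `Y` has `g * C b a'` in row
  -- `a` of column `a'`. `WithZero G` is unfolded to `Option G`.
  refine ⟨Option.map (fun c => (a, g * c)) (show Option G from C b a'), fun b' => ?_⟩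
  have key : ∀ x y : WithZero G,
      ((Option.map (fun c => (c * g, b)) (show Option G from x)).elim 0
        fun p => (p.1 : WithZero G) * y) =
      (Option.map (fun c => (a, g * c)) (show Option G from y)).elim 0
        fun p => x * (p.2 : WithZero G) := by
    intro x y
    induction x using WithZero.recZeroCoe <;> induction y using WithZero.recZeroCoe
    · rfl
    · exact (zero_mul _).symm
    · exact mul_zero _
    · exact congrArg WithZero.coe (mul_assoc _ _ _)
  have e : (rees C a g b).mulEntry C b' a' =
      (Option.map (fun c => (c * g, b)) (show Option G from C b' a)).elim 0
        fun p => (p.1 : WithZero G) * C b a' := by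
    change (Option.map (fun c => (c * g, b)) (show Option G from C b' a)).elim 0 _ = _
    generalize (show Option G from C b' a) = o
    cases o <;> rfl
  rw [e, key]
  generalize (show Option G from C b a') = o
  cases o <;> rfl

/-- Each column of `C Y` is zero or a multiple of one column of `C`. Nonzero columns separate these
cases, non-proportionality recovers the row index, and cancelling a nonzero entry recovers the
coefficient. -/
theorem Linked.left_unique {C : B → A → WithZero G} (hne : ∀ a, ∃ b, C b a ≠ 0)
    (hprop : ∀ a a', (∃ g : G, ∀ b, C b a * (g : WithZero G) = C b a') → a = a')
    {X : RM B G} {Y Y' : CM A G} (h : Linked C X Y) (h' : Linked C X Y') : Y = Y' := by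
  apply CM.ext
  funext a
  have e : ∀ b, (Y.col a).elim 0 (fun p => C b p.1 * (p.2 : WithZero G)) =
      (Y'.col a).elim 0 fun p => C b p.1 * (p.2 : WithZero G) := fun b =>
    (linked_iff.1 h a b).symm.trans (linked_iff.1 h' a b)
  generalize Y.col a = o at e ⊢
  generalize Y'.col a = o' at e ⊢
  rcases o with _ | ⟨a₁, g₁⟩ <;> rcases o' with _ | ⟨a₂, g₂⟩
  · rfl
  · obtain ⟨b, hb⟩ := hne a₂
    exact absurd (e b).symm (mul_ne_zero hb WithZero.coe_ne_zero)
  · obtain ⟨b, hb⟩ := hne a₁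
    exact absurd (e b) (mul_ne_zero hb WithZero.coe_ne_zero)
  · obtain rfl : a₁ = a₂ := by
      refine hprop _ _ ⟨g₁ * g₂⁻¹, fun b => ?_⟩
      have eb : C b a₁ * (g₁ : WithZero G) = C b a₂ * (g₂ : WithZero G) := e b
      rw [WithZero.coe_mul, ← mul_assoc, eb, mul_assoc, ← WithZero.coe_mul, mul_inv_cancel,
        WithZero.coe_one, mul_one]
    obtain ⟨b, hb⟩ := hne a₁
    have hg : (g₁ : WithZero G) = g₂ := mul_left_cancel₀ hb (e b)
    rw [WithZero.coe_injective hg]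

theorem Hull.ext_right {C : B → A → WithZero G} (hne : ∀ a, ∃ b, C b a ≠ 0)
    (hprop : ∀ a a', (∃ g : G, ∀ b, C b a * (g : WithZero G) = C b a') → a = a')
    {s t : Hull C} (h : s.right = t.right) : s = t :=
  Hull.ext h (s.linked.left_unique hne hprop (h ▸ t.linked))

end Hull

/-! ## The structure matrices -/

theorem forkMatrix_ne_zero {b : Col} {a : Row} : forkMatrix b a ≠ 0 ↔ b ∈ a.support := by
  unfold forkMatrix
  split_ifs with h <;> simp [h]

theorem forkMatrix_column_ne_zero (a : Row) : ∃ b, forkMatrix b a ≠ 0 := by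
  simp only [forkMatrix_ne_zero]
  revert a
  decide

theorem Row.support_injective : ∀ a a' : Row, a.support = a'.support → a = a' := by
  decide

theorem forkMatrix_column_proportional (a a' : Row)
    (h : ∃ g : ℤˣ, ∀ b, forkMatrix b a * (g : WithZero ℤˣ) = forkMatrix b a') : a = a' := by
  obtain ⟨g, hg⟩ := h
  apply Row.support_injective
  ext b
  rw [← forkMatrix_ne_zero, ← forkMatrix_ne_zero, ← hg b]
  simp

theorem Col.eq_of_mem_support : ∀ b b' : Col,
    (∀ a : Row, a ≠ .a1 → (b ∈ a.support ↔ b' ∈ a.support)) → b = b' := by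
  decide

theorem isGMMatrix_forkMatrixA1 : IsGMMatrix forkMatrixA1 := by
  refine ⟨⟨1, -1, by decide⟩, fun b => ?_, fun a => forkMatrix_column_ne_zero a, fun b b' => ?_,
    fun a a' h => Subtype.ext (forkMatrix_column_proportional a a' h)⟩
  · have : ∃ a : Row, a ≠ .a1 ∧ b ∈ a.support := by revert b; decide
    obtain ⟨a, ha, hb⟩ := this
    exact ⟨⟨a, ha⟩, forkMatrix_ne_zero.2 hb⟩
  · rintro ⟨g, hg⟩
    apply Col.eq_of_mem_support
    intro a ha
    have h : (g : WithZero ℤˣ) * forkMatrix b a = forkMatrix b' a := hg ⟨a, ha⟩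
    rw [← forkMatrix_ne_zero, ← forkMatrix_ne_zero, ← h]
    simp

theorem TFA1_ext_right {s t : Hull forkMatrixA1} (h : s.right = t.right) : s = t :=
  Hull.ext_right isGMMatrix_forkMatrixA1.2.2.1 isGMMatrix_forkMatrixA1.2.2.2.2 h

theorem TF_ext_right {s t : Hull forkMatrix} (h : s.right = t.right) : s = t :=
  Hull.ext_right forkMatrix_column_ne_zero forkMatrix_column_proportional h

theorem exists_linked_forkMatrix (x : Letter Row) : ∃ Y, Linked forkMatrix (x.eval forkMatrix) Y := by
  rcases x with ⟨a, g, b⟩ | _ | _ | _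
  · exact linked_rees _ a g b
  all_goals
    rw [exists_linked_iff]
    simp only [Letter.eval]
    decide

/-- `σ` exchanges `a2` and `a3`, `τ` permutes `a4`, …, `a7` cyclically, and `r` takes the rows
through column `1` to `a2` and those through column `3` to `-a3`. -/
theorem exists_linked_forkMatrixA1 (x : Letter {a : Row // a ≠ Row.a1}) :
    ∃ Y, Linked forkMatrixA1 (x.eval forkMatrixA1) Y := by
  rcases x with ⟨a, g, b⟩ | _ | _ | _
  · exact linked_rees _ a g b
  all_goals
    rw [exists_linked_iff]
    simp only [Letter.eval]
    decide

/-! ## The embedding into the Tall Fork -/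

theorem exists_mem_TF (s : TFA1) : ∃ t : TF, t.1.right = s.1.right := by
  obtain ⟨s, hs⟩ := s
  induction hs using Subsemigroup.closure_induction with
  | mem s hs =>
    obtain ⟨x, hx⟩ := hs
    obtain ⟨y, hy⟩ : ∃ y : Letter Row, y.eval forkMatrix = x.eval forkMatrixA1 := by
      rcases x with ⟨a, g, b⟩ | _ | _ | _
      exacts [⟨.elt a g b, rfl⟩, ⟨.sigma, rfl⟩, ⟨.tau, rfl⟩, ⟨.r, rfl⟩]
    obtain ⟨Y, hY⟩ := exists_linked_forkMatrix y
    exact ⟨⟨⟨_, Y, hY⟩, Subsemigroup.subset_closure ⟨y, rfl⟩⟩, hy.trans hx.symm⟩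
  | mul s t _ _ hs ht =>
    obtain ⟨s', hs'⟩ := hs
    obtain ⟨t', ht'⟩ := ht
    exact ⟨s' * t', congrArg₂ (· * ·) hs' ht'⟩

theorem exists_embedding :
    ∃ φ : TFA1 →ₙ* TF, Function.Injective φ ∧ ∀ s : TFA1, (φ s).1.right = s.1.right := by
  -- An arbitrary choice is already a homomorphism, since elements of `TF` are determined by their
  -- right components.
  choose φ hφ using exists_mem_TF
  refine ⟨⟨φ, fun s t => Subtype.ext (TF_ext_right ?_)⟩, fun s t h => ?_, hφ⟩
  · exact (hφ (s * t)).trans (congrArg₂ (· * ·) (hφ s) (hφ t)).symm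
  · apply Subtype.ext
    apply TFA1_ext_right
    rw [← hφ s, ← hφ t]
    exact congrArg (fun u : TF => u.1.right) h

/-! ## The flip-flop -/

def PT.const (s : State) : PT State := ⟨fun _ => some s⟩

theorem const_mem (s : State) : PT.const s ∈ flipFlop.semigroup := by
  apply Subsemigroup.subset_closure
  cases s
  · exact ⟨.elt ⟨.a2, by decide⟩ 1 .one', rfl⟩
  · exact ⟨.r, rfl⟩

theorem flipFlop_semigroup : (flipFlop.semigroup : Set (PT State)) = rightZeroOne State := by
  apply Set.Subset.antisymm
  · intro f hf
    induction hf using Subsemigroup.closure_induction with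
    | mem f hf =>
      obtain ⟨x, rfl⟩ := hf
      rcases x with ⟨a, g, b⟩ | _ | _ | _
      · by_cases h : b = .one' ∨ b = .three'
        · exact Or.inr ⟨.p, by simp [flipFlop, h]⟩
        · exact Or.inr ⟨.q, by simp [flipFlop, h]⟩
      · exact Or.inl rfl
      · exact Or.inl rfl
      · exact Or.inr ⟨.q, rfl⟩
    | mul f g _ _ hf hg =>
      rcases hf with rfl | ⟨s, rfl⟩ <;> rcases hg with rfl | ⟨t, rfl⟩
      exacts [Or.inl rfl, Or.inr ⟨t, rfl⟩, Or.inr ⟨s, rfl⟩, Or.inr ⟨t, rfl⟩]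
  · rintro f (rfl | ⟨s, rfl⟩)
    · exact Subsemigroup.subset_closure ⟨.sigma, rfl⟩
    · exact const_mem s

theorem isAperiodic_flipFlop : IsAperiodic flipFlop.semigroup := by
  apply isAperiodic_of_cube_eq_sq
  rintro ⟨f, hf⟩
  apply Subtype.ext
  change f ∈ (flipFlop.semigroup : Set (PT State)) at hf
  rw [flipFlop_semigroup] at hf
  rcases hf with rfl | ⟨s, rfl⟩ <;> rfl

/-! ## The flow -/

theorem spc_isInvariant {B G : Type} [Group G] (θ : SP B) (f : B → G) :
    (spc θ f).IsInvariant := by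
  refine ⟨fun _ _ h => h, ?_⟩
  rintro k y z ⟨h, l, h1, h2⟩
  exact ⟨h, k * l, by simp [h1, mul_assoc], by simp [h2, mul_assoc]⟩

theorem spc_isCrossSection {B G : Type} [Group G] (θ : SP B) (f : B → G) :
    (spc θ f).IsCrossSection := by
  rintro g h b ⟨_, k, h1, h2⟩
  exact h1.trans h2.symm

/-- The sign of a column in the cross-sections of the flow. -/
def Col.sign (b : Col) : ℤˣ := if b = .three' then -1 else 1

/-- The state over whose block a column lies. -/
def Col.state (b : Col) : State := if b = .one' ∨ b = .three' then .p else .q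

theorem Col.sign_mul_self (b : Col) : b.sign * b.sign = 1 := by
  revert b; decide

theorem mem_flow {s : State} {y : ℤˣ × Col} : y ∈ (flow s).carrier ↔ y.2.state = s := by
  obtain ⟨g, b⟩ := y
  cases s <;> cases b <;> simp [flow, spc, SP.oneBlock, Col.state]

/-- Signs are their own inverses, so the scalar `k` naming a block is read off as `y.1 * y.2.sign`.
One formula serves both states because all signs over `q` are `1`. -/
theorem flow_rel {s : State} {y z : ℤˣ × Col} : (flow s).rel y z ↔
    y.2.state = s ∧ z.2.state = s ∧ y.1 * y.2.sign = z.1 * z.2.sign := by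
  have e : (flow s).rel y z ↔ (y.2.state = s ∧ z.2.state = s) ∧
      ∃ k : ℤˣ, y.1 = k * y.2.sign ∧ z.1 = k * z.2.sign := by
    rw [← mem_flow (y := y), ← mem_flow (y := z)]
    obtain ⟨g, b⟩ := y
    obtain ⟨h, c⟩ := z
    cases s
    · exact Iff.rfl
    · refine and_congr_right fun hm => ?_
      have : ∀ b : Col, b ∈ ({.one, .two, .three, .four} : Set Col) → b.sign = 1 := by
        rintro b (rfl | rfl | rfl | rfl) <;> rfl
      have hb := this b hm.1
      have hc := this c hm.2
      simp only [hb, hc]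
  rw [e, and_assoc]
  refine and_congr_right fun _ => and_congr_right fun _ => ?_
  constructor
  · rintro ⟨k, h1, h2⟩
    rw [h1, h2, mul_assoc, mul_assoc, Col.sign_mul_self, Col.sign_mul_self]
  · intro h
    refine ⟨y.1 * y.2.sign, ?_, ?_⟩
    · rw [mul_assoc, Col.sign_mul_self, mul_one]
    · rw [h, mul_assoc, Col.sign_mul_self, mul_one]

/-- The common sign of the columns in the support of a row other than `a_1`. -/
def Row.sign (a : Row) : ℤˣ := if a = .a3 then -1 else 1

theorem Col.sign_of_mem_support : ∀ (a : Row) (b : Col), a ≠ .a1 → b ∈ a.support →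
    b.sign = a.sign := by
  decide

theorem rees_act (a : {a : Row // a ≠ Row.a1}) (g : ℤˣ) (b : Col) (y : ℤˣ × Col) :
    (rees forkMatrixA1 a g b).act y = if y.2 ∈ a.1.support then some (y.1 * g, b) else none := by
  change ((Option.map (fun c => (c * g, b)) (show Option ℤˣ from forkMatrix y.2 a)).map
    fun p => (y.1 * p.1, p.2)) = _
  unfold forkMatrix
  split_ifs
  · change some (y.1 * (1 * g), b) = _
    rw [one_mul]
  · rfl

/-- The action of `x` on the state of the flip-flop. -/
def stepState (x : Letter {a : Row // a ≠ Row.a1}) (s : State) : State :=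
  match x with
  | .elt _ _ b => b.state
  | .sigma => s
  | .tau => s
  | .r => .q

theorem flipFlop_step (x : Letter {a : Row // a ≠ Row.a1}) (s : State) :
    flipFlop.step s x = some (stepState x s) := by
  rcases x with ⟨a, g, b⟩ | _ | _ | _
  · cases b <;> rfl
  all_goals rfl

/-- The factor by which `x` multiplies the blocks of the flow. -/
def blockFactor : Letter {a : Row // a ≠ Row.a1} → ℤˣ
  | .elt a g b => a.1.sign * g * b.sign
  | .sigma => -1
  | .tau => 1
  | .r => 1

/-- The factor depends on the letter alone. `σ` changes the sign of the column and so has factor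
`-1`; in `r` the entry `-1` at `3'` compensates for the loss of sign from `3'` to `3`. -/
theorem act_block (x : Letter {a : Row // a ≠ Row.a1}) {y z : ℤˣ × Col}
    (h : (x.eval forkMatrixA1).act y = some z) :
    z.2.state = stepState x y.2.state ∧ z.1 * z.2.sign = y.1 * y.2.sign * blockFactor x := by
  rcases x with ⟨a, g, b⟩ | _ | _ | _
  · simp only [Letter.eval, rees_act] at h
    split_ifs at h with hy
    obtain rfl := Option.some.inj h
    refine ⟨rfl, ?_⟩
    have := Col.sign_of_mem_support a y.2 a.2 hy
    simp only [blockFactor, ← this]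
    calc y.1 * g * b.sign = y.1 * (y.2.sign * y.2.sign) * g * b.sign := by
          rw [Col.sign_mul_self, mul_one]
      _ = _ := by simp only [mul_assoc]
  all_goals
    obtain ⟨k, b⟩ := y
    cases b <;> simp [Letter.eval, RM.act, sigma, tau, rho] at h <;> subst h <;>
      simp [Col.state, Col.sign, stepState, blockFactor]

theorem isCompleteFlow_flow : IsCompleteFlow (Letter.eval forkMatrixA1) flipFlop flow := by
  have hmaps : ∀ s x, ∀ y ∈ (flow s).carrier, ∀ z, (x.eval forkMatrixA1).act y = some z →
      z ∈ (flow (stepState x s)).carrier := by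
    intro s x y hy z hz
    rw [mem_flow] at hy ⊢
    rw [← hy]
    exact (act_block x hz).1
  have hinj : ∀ s x, ∀ y ∈ (flow s).carrier, ∀ y' ∈ (flow s).carrier, ∀ z z',
      (x.eval forkMatrixA1).act y = some z → (x.eval forkMatrixA1).act y' = some z' →
      ((flow s).rel y y' ↔ (flow (stepState x s)).rel z z') := by
    intro s x y hy y' hy' z z' hz hz'
    have mz := mem_flow.1 (hmaps s x y hy z hz)
    have mz' := mem_flow.1 (hmaps s x y' hy' z' hz')
    rw [mem_flow] at hy hy'
    -- Both block indices are multiplied by the same factor, which cancels; this gives both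
    -- directions.
    rw [flow_rel, flow_rel, (act_block x hz).2, (act_block x hz').2, mul_left_inj]
    simp only [hy, hy', mz, mz', true_and]
  have hcross : ∀ s, (flow s).IsCrossSection := by
    rintro (_ | _)
    · exact spc_isCrossSection (G := ℤˣ) (SP.oneBlock _) fun b => if b = Col.three' then -1 else 1
    · exact spc_isCrossSection (G := ℤˣ) (SP.oneBlock _) fun _ => 1
  have hinv : ∀ s, (flow s).IsInvariant := by
    rintro (_ | _)
    · exact spc_isInvariant (G := ℤˣ) (SP.oneBlock _) fun b => if b = Col.three' then -1 else 1
    · exact spc_isInvariant (G := ℤˣ) (SP.oneBlock _) fun _ => 1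
  have hcov : ∀ y, ∃ s, y ∈ (flow s).carrier := fun y => ⟨_, mem_flow.2 rfl⟩
  refine ⟨⟨hcov, ?_, ?_, hcross, hinv⟩, ⟨fun y => ?_, ?_, ?_, ?_, ?_⟩⟩
  · intro s x s' hs
    rw [flipFlop_step] at hs
    obtain rfl := Option.some.inj hs
    exact hmaps s x
  · intro s x s' hs
    rw [flipFlop_step] at hs
    obtain rfl := Option.some.inj hs
    exact hinj s x
  · obtain ⟨s, hs⟩ := hcov y
    exact ⟨some s, hs⟩
  -- The flip-flop has no undefined transitions, so the sink is reached only from itself, and its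
  -- carrier is empty.
  · rintro (_ | s) x s' hs
    · rintro y ⟨⟩
    · change some (flipFlop.step s x) = _ at hs
      rw [flipFlop_step] at hs
      obtain rfl := Option.some.inj hs
      exact hmaps s x
  · rintro (_ | s) x s' hs
    · rintro y ⟨⟩
    · change some (flipFlop.step s x) = _ at hs
      rw [flipFlop_step] at hs
      obtain rfl := Option.some.inj hs
      exact hinj s x
  · rintro (_ | s)
    · rintro g h b ⟨⟩
    · exact hcross s
  · rintro (_ | s)
    · exact ⟨fun _ _ h => h, fun _ _ _ h => h⟩
    · exact hinv s

/-! ## The lower bound for the complexity -/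

theorem not_isAperiodic_TFA1 : ¬ IsAperiodic TFA1 := by
  intro hap
  obtain ⟨Y, hY⟩ := exists_linked_forkMatrixA1 .sigma
  let g : TFA1 := ⟨⟨sigma, Y, hY⟩, Subsemigroup.subset_closure ⟨.sigma, rfl⟩⟩
  have hcube : g * g * g = g := by
    apply Subtype.ext
    apply TFA1_ext_right
    change sigma * sigma * sigma = sigma
    apply RM.ext
    funext b
    cases b <;> rfl
  have h := hap (g * g) g g (by rw [← mul_assoc, hcube]) hcube (by rw [← mul_assoc, hcube]) rfl rfl
  have h' : sigma.row .one' = (sigma * sigma).row .one' :=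
    congrArg (fun s : TFA1 => s.1.right.row .one') h
  revert h'
  decide

/-! ## The upper bound for the complexity -/

/-- The partial maps on `Q` that are restrictions of the identity or of constant maps. -/
def idOrConst (Q : Type) : Subsemigroup (PT Q) where
  carrier := {f | (∀ c c', f.app c = some c' → c' = c) ∨
    ∃ d, ∀ c c', f.app c = some c' → c' = d}
  mul_mem' := by
    rintro f g hf hg
    simp only [Set.mem_ofPred_eq, PT.mul_app, Option.bind_eq_some_iff] at hf hg ⊢
    rcases hg with hg | ⟨d, hg⟩
    · rcases hf with hf | ⟨d, hf⟩
      · refine Or.inl ?_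
        rintro c c' ⟨c₁, h1, h2⟩
        exact (hg _ _ h2).trans (hf _ _ h1)
      · refine Or.inr ⟨d, ?_⟩
        rintro c c' ⟨c₁, h1, h2⟩
        exact (hg _ _ h2).trans (hf _ _ h1)
    · refine Or.inr ⟨d, ?_⟩
      rintro c c' ⟨c₁, h1, h2⟩
      exact hg _ _ h2

/-- A restricted identity is idempotent. A restricted constant map need not be: if its value lies
outside its domain, its square is empty. Hence the criterion `f * f * f = f * f`. -/
theorem isAperiodic_idOrConst (Q : Type) : IsAperiodic (idOrConst Q) := by
  apply isAperiodic_of_cube_eq_sq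
  rintro ⟨f, hf⟩
  apply Subtype.ext
  apply PT.ext
  funext c
  change ((f.app c).bind f.app).bind f.app = (f.app c).bind f.app
  rcases h1 : f.app c with _ | c₁
  · rfl
  · rcases h2 : f.app c₁ with _ | c₂
    · simp [h2]
    · simp only [Option.bind_some, h2]
      rcases hf with hf | ⟨d, hf⟩
      · rw [hf _ _ h2, h2, hf _ _ h2]
      · rw [hf _ _ h2, ← hf _ _ h1, h2, hf _ _ h2, hf _ _ h1]

/-- The group coordinate: a rotation of the square and the index of a block of the flow. -/
abbrev RotSign : Type := Multiplicative (ZMod 4) × ℤˣ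

/-- The wreath product of the group coordinate with the flip-flop. -/
abbrev BaseWreath : Type := Wreath RotSign flipFlop.semigroup

/-- The wreath product covering `TFA1`. -/
abbrev CoverWreath : Type := Wreath (idOrConst (ZMod 4)) BaseWreath

def resetState (s : State) : flipFlop.semigroup := ⟨PT.const s, const_mem s⟩

theorem resetState_injective : Function.Injective resetState := by
  intro s t h
  exact Option.some.inj (congrArg (fun f : flipFlop.semigroup => f.1.app .p) h)

theorem mul_resetState (u : WithOne flipFlop.semigroup) (s : State) :
    u * (resetState s : WithOne flipFlop.semigroup) = resetState s := by
  rcases u with _ | f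
  · exact one_mul _
  · change (f : WithOne flipFlop.semigroup) * _ = _
    rw [← WithOne.coe_mul]
    congr 1
    obtain ⟨f, hf⟩ := f
    apply Subtype.ext
    change f ∈ (flipFlop.semigroup : Set (PT State)) at hf
    rw [flipFlop_semigroup] at hf
    rcases hf with rfl | ⟨t, rfl⟩ <;> rfl

/-- The element resetting the state to `s` and the group coordinate to `z`. -/
def point (v : State × RotSign) : BaseWreath := ⟨fun _ => v.2, resetState v.1⟩

theorem point_injective : Function.Injective point := by
  rintro ⟨s, z⟩ ⟨t, w⟩ h
  have h1 : resetState s = resetState t := congrArg Wreath.base h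
  have h2 : z = w := congrFun (congrArg Wreath.fn h) 1
  rw [resetState_injective h1, h2]

/-- Resets are right zeros even after adjoining an identity, so the argument of `w.fn` is always
`resetState s`. The points thus let right multiplication inside the wreath product act on pairs of a
state and a group element. -/
theorem point_mul (s s' : State) (z : RotSign) (w : BaseWreath)
    (h : resetState s * w.base = resetState s') :
    point (s, z) * w = point (s', z * w.fn (resetState s)) := by
  apply Wreath.ext
  · funext u
    change z * w.fn (u * (resetState s : WithOne flipFlop.semigroup)) = _
    rw [mul_resetState]
    rfl
  · exact h

/-- The column in a given position, in the block over a given state. -/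
def colAt (s : State) (m : ZMod 4) : Option Col :=
  match s with
  | .p => if m = 0 then some .one' else if m = 2 then some .three' else none
  | .q => if m = 0 then some .one else if m = 1 then some .two else
      if m = 2 then some .three else some .four

/-- The position of a column in its block. -/
def Col.pos : Col → ZMod 4
  | .one' => 0
  | .three' => 2
  | .one => 0
  | .two => 1
  | .three => 2
  | .four => 3

theorem colAt_pos (b : Col) : colAt b.state b.pos = some b := by
  revert b; decide

theorem eq_of_colAt {s : State} {m : ZMod 4} {b : Col} (h : colAt s m = some b) :
    b.state = s ∧ b.pos = m := by
  revert m
  cases s <;> cases b <;> decide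

/-- The point of `G × B` with given coordinates. -/
def decode (s : State) (z : RotSign) (c : ZMod 4) : Option (ℤˣ × Col) :=
  (colAt s (z.1.toAdd + c)).map fun b => (z.2 * b.sign, b)

theorem decode_pos (n : Multiplicative (ZMod 4)) (k : ℤˣ) (b : Col) :
    decode b.state (n, k * b.sign) (b.pos - n.toAdd) = some (k, b) := by
  simp [decode, colAt_pos, mul_assoc]

/-- `w` acts on the coordinates of the points as `X` acts on the points. -/
def Covers (w : CoverWreath) (X : RM Col ℤˣ) : Prop :=
  ∀ s z, ∃ s' z', point (s, z) * w.base = point (s', z') ∧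
    ∀ c, ((w.fn (point (s, z))).1.app c).bind (decode s' z') = (decode s z c).bind X.act

theorem Covers.mul {w w' : CoverWreath} {X X' : RM Col ℤˣ} (h : Covers w X) (h' : Covers w' X') :
    Covers (w * w') (X * X') := by
  intro s z
  obtain ⟨s₁, z₁, e₁, h₁⟩ := h s z
  obtain ⟨s₂, z₂, e₂, h₂⟩ := h' s₁ z₁
  refine ⟨s₂, z₂, ?_, fun c => ?_⟩
  · rw [← e₂, ← e₁, mul_assoc]
    rfl
  · have e : ((w * w').fn (point (s, z))).1.app c =
        ((w.fn (point (s, z))).1.app c).bind (w'.fn (point (s₁, z₁))).1.app := by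
      rw [← e₁]
      rfl
    have e' : (X * X').act = fun y => (X.act y).bind X'.act := funext (RM.mul_act X X')
    rw [e, e', Option.bind_assoc, funext h₂, ← Option.bind_assoc, h₁, Option.bind_assoc]

/-- Every point of `G × B` has coordinates, for instance with trivial rotation, so the action on
coordinates determines the matrix. This makes the covering relation a well-defined map. -/
theorem Covers.unique {w : CoverWreath} {X X' : RM Col ℤˣ} (h : Covers w X) (h' : Covers w X') :
    X = X' := by
  apply RM.ext_act
  rintro ⟨k, b⟩
  obtain ⟨s₁, z₁, e₁, h₁⟩ := h b.state (1, k * b.sign)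
  obtain ⟨s₂, z₂, e₂, h₂⟩ := h' b.state (1, k * b.sign)
  obtain ⟨rfl, rfl⟩ := Prod.mk.inj (point_injective (e₁.symm.trans e₂))
  have := (h₁ (b.pos - Multiplicative.toAdd 1)).symm.trans (h₂ _)
  simpa only [decode_pos, Option.bind_some] using this

/-- The rotation that `x` effects on the group coordinate. -/
def rotation : Letter {a : Row // a ≠ Row.a1} → Multiplicative (ZMod 4)
  | .elt _ _ _ => 1
  | .sigma => .ofAdd 2
  | .tau => .ofAdd 1
  | .r => 1

/-- The restrictions of the identity and of constant maps. -/
def restrict {Q : Type} (D : Q → Bool) (d : Option Q) : idOrConst Q :=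
  ⟨⟨fun c => if D c then some (d.getD c) else none⟩, by
    rcases d with _ | d
    · refine Or.inl fun c c' h => ?_
      change (if D c then some c else none) = some c' at h
      split_ifs at h
      exact (Option.some.inj h).symm
    · refine Or.inr ⟨d, fun c c' h => ?_⟩
      change (if D c then some d else none) = some c' at h
      split_ifs at h
      exact (Option.some.inj h).symm⟩

/-- The action of `x` on the aperiodic coordinate. -/
def topAction (x : Letter {a : Row // a ≠ Row.a1}) (v : State × RotSign) :
    idOrConst (ZMod 4) :=
  restrict (fun c => ((decode v.1 v.2 c).bind (x.eval forkMatrixA1).act).isSome)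
    (match x with
      | .elt _ _ b => some (b.pos - v.2.1.toAdd)
      | _ => none)

/-- `σ`, `τ` and `r` shift positions by `2`, `1` and `0` wherever they are defined, which is the
translation of `n`, so `c` stays fixed. For `(a, g, b)` the rotation is trivial and `c` is reset to
`b.pos - n`. Where `x` is undefined the domain of `topAction` makes both sides `none`, so it is
harmless that `σ` and `τ` translate the group coordinate over the other state too. -/
theorem decode_step (x : Letter {a : Row // a ≠ Row.a1}) (s : State) (z : RotSign)
    (c : ZMod 4) :
    ((topAction x (s, z)).1.app c).bind (decode (stepState x s) (z * (rotation x, blockFactor x))) =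
      (decode s z c).bind (x.eval forkMatrixA1).act := by
  simp only [topAction, restrict]
  rcases hy : (decode s z c).bind (x.eval forkMatrixA1).act with _ | y
  · simp
  · obtain ⟨n, k⟩ := z
    simp only [Option.isSome_some, if_true, Option.bind_some]
    rcases hd : colAt s (n.toAdd + c) with _ | b'
    · simp [decode, hd] at hy
    have hy' : (x.eval forkMatrixA1).act (k * b'.sign, b') = some y := by
      simpa [decode, hd] using hy
    have hk : y.1 * y.2.sign = k * blockFactor x := by
      rw [(act_block x hy').2, mul_assoc k, Col.sign_mul_self, mul_one]
    suffices hcol : colAt (stepState x s) (n.toAdd + (rotation x).toAdd +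
        Option.getD (match x with | .elt _ _ b => some (b.pos - n.toAdd) | _ => none) c) =
          some y.2 by
      simp only [decode, Prod.mk_mul_mk, toAdd_mul, hcol, Option.map_some, ← hk, mul_assoc,
        Col.sign_mul_self, mul_one]
    rcases x with ⟨a, g, b⟩ | _ | _ | _
    · simp only [Letter.eval, rees_act] at hy'
      split_ifs at hy'
      obtain rfl := Option.some.inj hy'
      simp [rotation, stepState, colAt_pos]
    all_goals
      simp only [Option.getD_none, rotation, toAdd_ofAdd, toAdd_one, add_zero, stepState,
        add_right_comm n.toAdd _ c]
      obtain ⟨rfl, hm⟩ := eq_of_colAt hd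
      rw [← hm]
      cases b' <;> simp [Letter.eval, RM.act, sigma, tau, rho] at hy' <;> subst hy' <;>
        dsimp only <;> decide

theorem exists_covers (x : Letter {a : Row // a ≠ Row.a1}) :
    ∃ w, Covers w (x.eval forkMatrixA1) := by
  have : Nonempty (State × RotSign) := ⟨(.p, 1)⟩
  have hp : Function.Injective fun v => (point v : WithOne BaseWreath) :=
    WithOne.coe_injective.comp point_injective
  let t : flipFlop.semigroup := ⟨_, Subsemigroup.subset_closure ⟨x, rfl⟩⟩
  have ht : ∀ s, resetState s * t = resetState (stepState x s) := by
    intro s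
    apply Subtype.ext
    apply PT.ext
    funext _
    exact flipFlop_step x s
  -- `invFun` reads the coordinates back from a point; its values off the points do not matter.
  refine ⟨⟨fun u => topAction x (Function.invFun (fun v => (point v : WithOne BaseWreath)) u),
    ⟨fun _ => (rotation x, blockFactor x), t⟩⟩, fun s z =>
      ⟨stepState x s, z * (rotation x, blockFactor x), point_mul _ _ _ _ (ht s), fun c => ?_⟩⟩
  have e := Function.leftInverse_invFun hp (s, z)
  change ((topAction x (Function.invFun _ _)).1.app c).bind _ = _
  rw [e]
  exact decode_step x s z c

theorem divides_TFA1 : Divides TFA1 CoverWreath := by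
  let U : Subsemigroup CoverWreath :=
    { carrier := {w | ∃ s : TFA1, Covers w s.1.right}
      mul_mem' := by
        rintro w w' ⟨s, hs⟩ ⟨s', hs'⟩
        exact ⟨s * s', hs.mul hs'⟩ }
  -- By uniqueness the chosen element is the only one covered, so the choice is multiplicative.
  choose φ hφ using fun w : U => w.2
  have huniq : ∀ (w : U) (s : TFA1), Covers w.1 s.1.right → φ w = s := fun w s h =>
    Subtype.ext (TFA1_ext_right ((hφ w).unique h))
  refine ⟨U, ⟨φ, fun w w' => huniq _ _ ((hφ w).mul (hφ w'))⟩, ?_⟩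
  rintro ⟨s, hs⟩
  suffices ∃ w, Covers w s.right by
    obtain ⟨w, hw⟩ := this
    exact ⟨⟨w, ⟨s, hs⟩, hw⟩, huniq _ _ hw⟩
  induction hs using Subsemigroup.closure_induction with
  | mem s hs =>
    obtain ⟨x, hx⟩ := hs
    rw [hx]
    exact exists_covers x
  | mul s t _ _ hs ht =>
    obtain ⟨w, hw⟩ := hs
    obtain ⟨w', hw'⟩ := ht
    exact ⟨w * w', hw.mul hw'⟩

instance : Finite State :=
  Finite.of_injective (fun s => decide (s = State.p)) (by
    intro s t
    cases s <;> cases t <;> decide)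

theorem hasComplexity_TFA1 : HasComplexity TFA1 1 := by
  refine ⟨⟨idOrConst (ZMod 4), RotSign, flipFlop.semigroup, inferInstance, inferInstance,
    inferInstance, ?_, isAperiodic_idOrConst _, ?_, ⟨?_, isAperiodic_flipFlop⟩, divides_TFA1⟩, ?_⟩
  · have : Finite (ZMod 4) := inferInstanceAs (Finite (Fin 4))
    exact Subtype.finite
  · have : Finite (Multiplicative (ZMod 4)) := inferInstanceAs (Finite (Fin 4))
    infer_instance
  · exact Subtype.finite
  · intro m hm
    rcases m with _ | m
    · exact absurd hm.2 not_isAperiodic_TFA1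
    · exact Nat.succ_le_succ (Nat.zero_le m)

end KR

theorem mainTheorem7 :
    -- the structure matrix defines a group mapping semigroup
    KR.IsGMMatrix KR.forkMatrixA1 ∧
    -- every generator lies, in a unique way, in the translational hull
    (∀ x : KR.Letter {a : KR.Row // a ≠ KR.Row.a1},
      ∃! Y : KR.CM {a : KR.Row // a ≠ KR.Row.a1} ℤˣ,
        KR.Linked KR.forkMatrixA1 (x.eval KR.forkMatrixA1) Y) ∧
    -- the semigroup embeds in the Tall Fork, with the same action on `G × B`
    (∃ φ : KR.TFA1 →ₙ* KR.TF, Function.Injective φ ∧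
      ∀ s : KR.TFA1, (φ s).1.right = s.1.right) ∧
    -- the automaton has the flip-flop as its semigroup, which is aperiodic
    (KR.flipFlop.semigroup : Set (KR.PT KR.State)) = KR.rightZeroOne KR.State ∧
    KR.IsAperiodic KR.flipFlop.semigroup ∧
    -- the explicit map is a (complete) flow
    KR.IsCompleteFlow (KR.Letter.eval KR.forkMatrixA1) KR.flipFlop KR.flow ∧
    -- the complexity is one
    KR.HasComplexity KR.TFA1 1 := by
  exact ⟨KR.isGMMatrix_forkMatrixA1,
    fun x => (KR.exists_linked_forkMatrixA1 x).elim fun Y hY => ⟨Y, hY, fun _ hZ =>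
      hZ.left_unique KR.isGMMatrix_forkMatrixA1.2.2.1 KR.isGMMatrix_forkMatrixA1.2.2.2.2 hY⟩,
    KR.exists_embedding, KR.flipFlop_semigroup, KR.isAperiodic_flipFlop, KR.isCompleteFlow_flow,
    KR.hasComplexity_TFA1⟩
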